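/- An indexed grammar consists of mutually disjoint sets $\mathcal N$ (nonterminals), $\mathcal T$ (terminals) and $\mathcal I$ (flags), a start symbol $S\in\mathcal N$, and a finite set of productions, each of one of the forms $A\to B^f$, $A^f\to v$, $A\to u$, where $A,B\in\mathcal N$, $f\in\mathcal I$ and $u,v\in(\mathcal N\cup\mathcal T)^*$. In a derivation every nonterminal carries a flag word in $\mathcal I^*$, and for $\gamma,\delta\in\mathcal I^*$: the production $A\to B^f$ replaces an occurrence of $A^\gamma$ by $B^{f\gamma}$; the production $A^f\to v$ replaces an occurrence of $A^{f\delta}$ by $v$ with the flag word $\delta$ attached to every nonterminal of $v$; the production $A\to u$ replaces an occurrence of $A^\gamma$ by $u$ with the flag word $\gamma$ attached to every nonterminal of $u$. The language of the grammar is the set of words over $\mathcal T$ derivable from $S$ with empty flag word. A language is indexed if it is the language of some indexed grammar. Proposition. Let $\tau\in S_\ell$ be a permutation of $\{1,\ldots,\ell\}$. If $L$ is a context-free language, then the language $$L_\tau=\{\,w_{\tau(1)}\cdots w_{\tau(\ell)} \mid w_1\cdots w_\ell\in L,\ w_i\neq\varepsilon\ (1\le i\le \ell)\,\}$$ is indexed.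 -/

import Mathlib

/-- A production of an indexed grammar with terminals `T`, nonterminals `N` and flags (indices) `I`.
Each of the three forms is applied to a nonterminal `A` carrying a flag word. -/
inductive IndexedProduction (T N I : Type*) where
  /-- The production `A → B^f`. -/
  | push (A B : N) (f : I)
  /-- The production `A^f → v`. -/
  | pop (A : N) (f : I) (v : List (Symbol T N))
  /-- The production `A → u`. -/
  | plain (A : N) (u : List (Symbol T N))

/-- An indexed grammar over the terminals `T`. Nonterminals, terminals and flags form three separate
types, so they are mutually disjoint; there are finitely many productions. -/
structure IndexedGrammar (T : Type*) where
  /-- The nonterminals. -/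
  NT : Type
  /-- The flags (indices). -/
  Flag : Type
  /-- The start symbol. -/
  initial : NT
  /-- The productions. -/
  productions : Finset (IndexedProduction T NT Flag)

/-- Attach the flag word `γ` to every nonterminal of `u`; terminals carry no flag. -/
def attachFlag {T N I : Type*} (γ : List I) (u : List (Symbol T N)) :
    List (Symbol T (N × List I)) :=
  u.map fun s => match s with
    | Symbol.terminal a => Symbol.terminal a
    | Symbol.nonterminal B => Symbol.nonterminal (B, γ)

/-- `p.Expands A γ s`: applying the production `p` to `A^γ` replaces it by the string `s`. -/
inductive IndexedProduction.Expands {T N I : Type*} :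
    IndexedProduction T N I → N → List I → List (Symbol T (N × List I)) → Prop
  /-- `A → B^f` replaces `A^γ` by `B^(fγ)`. -/
  | push (A B : N) (f : I) (γ : List I) :
      Expands (.push A B f) A γ [Symbol.nonterminal (B, f :: γ)]
  /-- `A^f → v` replaces `A^(fδ)` by `v` with `δ` attached to each nonterminal. -/
  | pop (A : N) (f : I) (v : List (Symbol T N)) (δ : List I) :
      Expands (.pop A f v) A (f :: δ) (attachFlag δ v)
  /-- `A → u` replaces `A^γ` by `u` with `γ` attached to each nonterminal. -/
  | plain (A : N) (u : List (Symbol T N)) (γ : List I) :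
      Expands (.plain A u) A γ (attachFlag γ u)

namespace IndexedGrammar

/-- One rewriting step: some production is applied to one flagged nonterminal of the string `u`. -/
def Produces {T : Type*} (g : IndexedGrammar T)
    (u v : List (Symbol T (g.NT × List g.Flag))) : Prop :=
  ∃ p ∈ g.productions, ∃ (A : g.NT) (γ : List g.Flag)
    (s x y : List (Symbol T (g.NT × List g.Flag))),
    p.Expands A γ s ∧ u = x ++ [Symbol.nonterminal (A, γ)] ++ y ∧ v = x ++ s ++ y

/-- Any finite number of rewriting steps. -/
def Derives {T : Type*} (g : IndexedGrammar T) :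
    List (Symbol T (g.NT × List g.Flag)) → List (Symbol T (g.NT × List g.Flag)) → Prop :=
  Relation.ReflTransGen g.Produces

/-- The words over the terminals derivable from the start symbol with empty flag. -/
def language {T : Type*} (g : IndexedGrammar T) : Language T :=
  {w : List T | g.Derives [Symbol.nonterminal (g.initial, [])] (w.map Symbol.terminal)}

end IndexedGrammar

/-- A language is indexed if it is generated by an indexed grammar. -/
def Language.IsIndexed {T : Type*} (L : Language T) : Prop :=
  ∃ g : IndexedGrammar T, g.language = L

/-- The language `L_τ` of all words `w_{τ(1)} ⋯ w_{τ(ℓ)}` with `w_1 ⋯ w_ℓ ∈ L` and all `w_i`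
nonempty. -/
def Language.permutedSubwords {T : Type*} (L : Language T) {ℓ : ℕ} (τ : Equiv.Perm (Fin ℓ)) :
    Language T :=
  {x : List T | ∃ w : Fin ℓ → List T, (∀ i, w i ≠ []) ∧ (List.ofFn w).flatten ∈ L ∧
    x = (List.ofFn fun i => w (τ i)).flatten}

/-!
A permuted subword decomposition of a word of a context-free language is recorded by marking, in a
derivation tree of the word, the leaf that carries the first letter of each subword. An indexed
grammar can guess the part of the tree that lies above the marked leaves, write it into the flag
word, and then copy this flag word to one nonterminal per subword, in whatever order the permutation
asks for. Each copy reads the same flag word and produces its own subword; the subtrees without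
marked leaves meet only one subword and are expanded without using flags.

A flag word is linear while the marked part of the tree branches. The branches are therefore written
one after the other, each flag naming the interval of marks below the tree node it describes, and a
nonterminal skips the flags that do not carry its own interval (`blockYield_append_of_skip`). This
is sound for every flag word, because all nonterminals for the same tree node read it in the same
way (`popString_cases`): the pieces generated from a common flag word are always the pieces of one
word of the language (`exists_markedWord_of_blockYield`). Conversely, every marked word comes from
some flag word (`exists_flags_of_generates`).

For a node with the marks `i, …, j - 1`, the pieces are the blocks `i, …, j` between consecutive
marks. Numbering blocks absolutely and declaring all other blocks empty makes the blocks of a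
concatenation the blockwise concatenation (`markedBlock_append`), also at the block shared by the
two factors. The context-free grammar is first brought into a form with right-hand sides of length
at most two (`ContextFreeGrammar.exists_quadraticGrammar`).
-/

/-! ### Rewriting and derivation trees -/

section Yield

variable {T N : Type*}

/-- One step of rewriting where `rel A s` says that the nonterminal `A` may be replaced by the
string `s`. The type `N` and the relation may be infinite, so that both context-free grammars and
indexed grammars (whose flagged nonterminals are the elements of `N`) are instances. -/
def RewriteStep (rel : N → List (Symbol T N) → Prop) (u v : List (Symbol T N)) : Prop :=
  ∃ (A : N) (s x y : List (Symbol T N)),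
    rel A s ∧ u = x ++ [Symbol.nonterminal A] ++ y ∧ v = x ++ s ++ y

/-- `Yield rel u w`: there is a forest of derivation trees with roots `u` and terminal word `w`. -/
inductive Yield (rel : N → List (Symbol T N) → Prop) : List (Symbol T N) → List T → Prop
  | nil : Yield rel [] []
  | terminal (a : T) {u : List (Symbol T N)} {w : List T} :
      Yield rel u w → Yield rel (Symbol.terminal a :: u) (a :: w)
  | nonterminal {A : N} {s u : List (Symbol T N)} {v w : List T} :
      rel A s → Yield rel s v → Yield rel u w → Yield rel (Symbol.nonterminal A :: u) (v ++ w)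

namespace Yield

variable {rel : N → List (Symbol T N) → Prop}

lemma nil_iff {w : List T} : Yield rel [] w ↔ w = [] :=
  ⟨fun h => by cases h; rfl, fun h => h ▸ .nil⟩

lemma terminal_iff {a : T} {u : List (Symbol T N)} {w : List T} :
    Yield rel (Symbol.terminal a :: u) w ↔ ∃ w', w = a :: w' ∧ Yield rel u w' :=
  ⟨fun h => by cases h with | terminal _ h => exact ⟨_, rfl, h⟩,
    fun ⟨_, hw, h⟩ => hw ▸ .terminal a h⟩

lemma append {u v : List (Symbol T N)} {w z : List T} (hu : Yield rel u w) (hv : Yield rel v z) :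
    Yield rel (u ++ v) (w ++ z) := by
  induction hu with
  | nil => exact hv
  | terminal a _ ih => exact .terminal a ih
  | nonterminal hr hs _ _ ih => rw [List.append_assoc]; exact .nonterminal hr hs ih

lemma exists_of_append {u v : List (Symbol T N)} {w : List T} (h : Yield rel (u ++ v) w) :
    ∃ w₁ w₂, w = w₁ ++ w₂ ∧ Yield rel u w₁ ∧ Yield rel v w₂ := by
  induction u generalizing w with
  | nil => exact ⟨[], w, rfl, .nil, h⟩
  | cons s u ih =>
    cases h with
    | terminal a h =>
      obtain ⟨w₁, w₂, rfl, h₁, h₂⟩ := ih h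
      exact ⟨_, w₂, rfl, .terminal a h₁, h₂⟩
    | nonterminal hr hs h =>
      obtain ⟨w₁, w₂, rfl, h₁, h₂⟩ := ih h
      exact ⟨_, w₂, (List.append_assoc ..).symm, .nonterminal hr hs h₁, h₂⟩

lemma append_iff {u v : List (Symbol T N)} {w : List T} :
    Yield rel (u ++ v) w ↔ ∃ w₁ w₂, w = w₁ ++ w₂ ∧ Yield rel u w₁ ∧ Yield rel v w₂ :=
  ⟨exists_of_append, fun ⟨_, _, hw, h₁, h₂⟩ => hw ▸ h₁.append h₂⟩

lemma singleton_iff {A : N} {w : List T} :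
    Yield rel [Symbol.nonterminal A] w ↔ ∃ s, rel A s ∧ Yield rel s w := by
  constructor
  · intro h
    cases h with
    | nonterminal hr hs h =>
      cases h
      exact ⟨_, hr, by simpa using hs⟩
  · rintro ⟨s, hr, hs⟩
    simpa using Yield.nonterminal hr hs .nil

lemma pair_iff {a b : Symbol T N} {w : List T} :
    Yield rel [a, b] w ↔ ∃ w₁ w₂, w = w₁ ++ w₂ ∧ Yield rel [a] w₁ ∧ Yield rel [b] w₂ :=
  append_iff (u := [a])

/-- A concatenation of strings yields exactly the concatenations of the words they yield. -/
lemma flatten_ofFn_iff {n : ℕ} {s : Fin n → List (Symbol T N)} {w : List T} :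
    Yield rel (List.ofFn s).flatten w ↔
      ∃ v : Fin n → List T, w = (List.ofFn v).flatten ∧ ∀ i, Yield rel (s i) (v i) := by
  induction n generalizing w with
  | zero => simp [nil_iff]
  | succ n ih =>
    rw [List.ofFn_succ, List.flatten_cons, append_iff]
    constructor
    · rintro ⟨w₁, w₂, rfl, h₁, h₂⟩
      obtain ⟨v, rfl, hv⟩ := ih.1 h₂
      exact ⟨Fin.cons w₁ v, by simp, Fin.cases (by simpa using h₁) (by simpa using hv)⟩
    · rintro ⟨v, rfl, hv⟩
      exact ⟨v 0, _, by rw [List.ofFn_succ, List.flatten_cons], hv 0,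
        ih.2 ⟨_, rfl, fun i => hv i.succ⟩⟩

lemma map_terminal (w : List T) : Yield rel (w.map Symbol.terminal) w := by
  induction w with
  | nil => exact .nil
  | cons a w ih => exact .terminal a ih

lemma of_step {u v : List (Symbol T N)} {w : List T} (huv : RewriteStep rel u v)
    (h : Yield rel v w) : Yield rel u w := by
  obtain ⟨A, s, x, y, hr, rfl, rfl⟩ := huv
  obtain ⟨w₁, w₂, rfl, h₁, hy⟩ := exists_of_append h
  obtain ⟨w₃, w₄, rfl, hx, hs⟩ := exists_of_append h₁
  exact (hx.append (singleton_iff.2 ⟨s, hr, hs⟩)).append hy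

end Yield

lemma RewriteStep.append {rel : N → List (Symbol T N) → Prop} {u v : List (Symbol T N)}
    (h : RewriteStep rel u v) (p q : List (Symbol T N)) :
    RewriteStep rel (p ++ u ++ q) (p ++ v ++ q) := by
  obtain ⟨A, s, x, y, hr, rfl, rfl⟩ := h
  exact ⟨A, s, p ++ x, y ++ q, hr, by simp, by simp⟩

lemma RewriteStep.reflTransGen_append {rel : N → List (Symbol T N) → Prop}
    {u v : List (Symbol T N)} (h : Relation.ReflTransGen (RewriteStep rel) u v)
    (p q : List (Symbol T N)) :
    Relation.ReflTransGen (RewriteStep rel) (p ++ u ++ q) (p ++ v ++ q) :=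
  h.lift (fun u => p ++ u ++ q) fun _ _ h => h.append p q

theorem yield_iff_reflTransGen {rel : N → List (Symbol T N) → Prop} {u : List (Symbol T N)}
    {w : List T} :
    Yield rel u w ↔ Relation.ReflTransGen (RewriteStep rel) u (w.map Symbol.terminal) := by
  constructor
  · intro h
    induction h with
    | nil => exact .refl
    | terminal a _ ih => simpa using RewriteStep.reflTransGen_append ih [Symbol.terminal a] []
    | @nonterminal A s u v w hr _ _ ihs ihu =>
      have h₁ : RewriteStep rel (Symbol.nonterminal A :: u) (s ++ u) :=
        ⟨A, s, [], u, hr, by simp, by simp⟩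
      have h₂ := RewriteStep.reflTransGen_append ihs [] u
      have h₃ := RewriteStep.reflTransGen_append ihu (v.map Symbol.terminal) []
      simp only [List.nil_append, List.append_nil] at h₂ h₃
      rw [List.map_append]
      exact .head h₁ (h₂.trans h₃)
  · intro h
    induction h using Relation.ReflTransGen.head_induction_on with
    | refl => exact .map_terminal w
    | head h _ ih => exact .of_step h ih

end Yield

/-- The rewriting relation of a context-free grammar. -/
def ContextFreeGrammar.Rel {T : Type*} (g : ContextFreeGrammar T) (A : g.NT)
    (s : List (Symbol T g.NT)) : Prop :=
  ⟨A, s⟩ ∈ g.rules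

lemma ContextFreeGrammar.mem_language_iff_yield {T : Type*} (g : ContextFreeGrammar T)
    (w : List T) : w ∈ g.language ↔ Yield g.Rel [Symbol.nonterminal g.initial] w := by
  have h : g.Produces = RewriteStep g.Rel := by
    ext u v
    simp only [ContextFreeGrammar.Produces, ContextFreeRule.rewrites_iff]
    constructor
    · rintro ⟨r, hr, x, y, rfl, rfl⟩
      exact ⟨r.input, r.output, x, y, hr, rfl, rfl⟩
    · rintro ⟨A, s, x, y, hr, rfl, rfl⟩
      exact ⟨⟨A, s⟩, hr, x, y, rfl, rfl⟩
  rw [yield_iff_reflTransGen, ← h]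
  rfl

/-- The rewriting relation of an indexed grammar on flagged nonterminals. -/
def IndexedGrammar.Rel {T : Type*} (g : IndexedGrammar T) (A : g.NT × List g.Flag)
    (s : List (Symbol T (g.NT × List g.Flag))) : Prop :=
  ∃ p ∈ g.productions, p.Expands A.1 A.2 s

lemma IndexedGrammar.mem_language_iff_yield {T : Type*} (g : IndexedGrammar T)
    (w : List T) : w ∈ g.language ↔ Yield g.Rel [Symbol.nonterminal (g.initial, [])] w := by
  have h : g.Produces = RewriteStep g.Rel := by
    ext u v
    constructor
    · rintro ⟨p, hp, A, γ, s, x, y, he, rfl, rfl⟩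
      exact ⟨(A, γ), s, x, y, ⟨p, hp, he⟩, rfl, rfl⟩
    · rintro ⟨⟨A, γ⟩, s, x, y, ⟨p, hp, he⟩, rfl, rfl⟩
      exact ⟨p, hp, A, γ, s, x, y, he, rfl, rfl⟩
  rw [yield_iff_reflTransGen, ← h]
  rfl

section attachFlag

variable {T N I : Type*} (γ : List I)

@[simp] lemma attachFlag_nil : attachFlag γ ([] : List (Symbol T N)) = [] := rfl

@[simp] lemma attachFlag_terminal (a : T) (u : List (Symbol T N)) :
    attachFlag γ (Symbol.terminal a :: u) = Symbol.terminal a :: attachFlag γ u := rfl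

@[simp] lemma attachFlag_nonterminal (A : N) (u : List (Symbol T N)) :
    attachFlag γ (Symbol.nonterminal A :: u) = Symbol.nonterminal (A, γ) :: attachFlag γ u := rfl

lemma attachFlag_append (u v : List (Symbol T N)) :
    attachFlag γ (u ++ v) = attachFlag γ u ++ attachFlag γ v := List.map_append ..

lemma attachFlag_flatten_ofFn {n : ℕ} (s : Fin n → List (Symbol T N)) :
    attachFlag γ (List.ofFn s).flatten = (List.ofFn fun i => attachFlag γ (s i)).flatten := by
  induction n with
  | zero => rfl
  | succ n ih => simp [List.ofFn_succ, attachFlag_append, ih]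

end attachFlag

/-! ### Context-free grammars in quadratic form -/

/-- The right-hand side of a rule in quadratic form: no rule at all, the empty word, a terminal
followed by a nonterminal, or two nonterminals. -/
inductive QuadraticBody (T X : Type*) where
  | stuck
  | eps
  | term (a : T) (y : X)
  | pair (y z : X)

/-- Renaming of nonterminals. -/
def QuadraticBody.map {T X Y : Type*} (f : X → Y) : QuadraticBody T X → QuadraticBody T Y
  | stuck => stuck
  | eps => eps
  | term a y => term a (f y)
  | pair y z => pair (f y) (f z)

/-- A context-free grammar in quadratic form with finitely many nonterminals. The rules of a
nonterminal `x` are the `body x c`, for `c` in a finite type of choices. All types except the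
terminals live in `Type`, as `IndexedGrammar` demands. -/
structure QuadraticGrammar (T : Type*) where
  /-- The nonterminals. -/
  NT : Type
  /-- The labels of the rules of each nonterminal. -/
  Choice : Type
  finite_NT : Finite NT
  finite_Choice : Finite Choice
  /-- The right-hand sides. -/
  body : NT → Choice → QuadraticBody T NT
  /-- The start symbol. -/
  initial : NT

attribute [instance] QuadraticGrammar.finite_NT QuadraticGrammar.finite_Choice

/-- `g.Generates x w`: the nonterminal `x` derives the word `w`. -/
inductive QuadraticGrammar.Generates {T : Type*} (g : QuadraticGrammar T) : g.NT → List T → Prop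
  | eps {x : g.NT} {c : g.Choice} : g.body x c = .eps → Generates g x []
  | term {x y : g.NT} {c : g.Choice} {a : T} {w : List T} :
      g.body x c = .term a y → Generates g y w → Generates g x (a :: w)
  | pair {x y z : g.NT} {c : g.Choice} {v w : List T} :
      g.body x c = .pair y z → Generates g y v → Generates g z w → Generates g x (v ++ w)

namespace ContextFreeGrammar

variable {T : Type*} (g : ContextFreeGrammar T)

/-- The strings that serve as nonterminals of the quadratic form: the suffixes of the right-hand
sides and of the initial string. -/
def items : Set (List (Symbol T g.NT)) :=
  {α | α <:+ [Symbol.nonterminal g.initial] ∨ ∃ r ∈ g.rules, α <:+ r.output}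

lemma finite_items : g.items.Finite := by
  have h (l : List (Symbol T g.NT)) : {α | α <:+ l}.Finite := by
    simpa using List.finite_toSet l.tails
  have h' : g.items = {α | α <:+ [Symbol.nonterminal g.initial]} ∪
      ⋃ r ∈ g.rules, {α | α <:+ r.output} := by
    ext; simp [items]
  rw [h']
  exact (h _).union (g.rules.finite_toSet.biUnion fun r _ => h _)

lemma items_tail {s : Symbol T g.NT} {α : List (Symbol T g.NT)} (h : s :: α ∈ g.items) :
    α ∈ g.items := by
  rcases h with h | ⟨r, hr, h⟩
  · exact .inl ((List.suffix_cons s α).trans h)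
  · exact .inr ⟨r, hr, (List.suffix_cons s α).trans h⟩

open Classical in
/-- The rules of the quadratic form: a string is expanded at its first symbol, the label
telling which rule of the grammar to use if that symbol is a nonterminal. -/
noncomputable def itemBody : List (Symbol T g.NT) → Option g.rules →
    QuadraticBody T (List (Symbol T g.NT))
  | [], _ => .eps
  | Symbol.terminal a :: α, _ => .term a α
  | Symbol.nonterminal _ :: _, none => .stuck
  | Symbol.nonterminal A :: α, some r => if r.1.input = A then .pair r.1.output α else .stuck

/-- Every context-free grammar has a quadratic form. -/
theorem exists_quadraticGrammar :
    ∃ h : QuadraticGrammar T, ∀ w, h.Generates h.initial w ↔ w ∈ g.language := by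
  have := g.finite_items.to_subtype
  obtain ⟨n, ⟨e⟩⟩ := Finite.exists_equiv_fin g.items
  obtain ⟨m, ⟨e'⟩⟩ := Finite.exists_equiv_fin (Option g.rules)
  have hinit : [Symbol.nonterminal g.initial] ∈ g.items := .inl (List.suffix_refl _)
  -- Items are coded by numbers since they are not in `Type` when `T` is not; `enc` has an arbitrary
  -- value on strings that are not items.
  let dec : Fin n → List (Symbol T g.NT) := fun x => (e.symm x).1
  have : Nonempty (Fin n) := ⟨e ⟨_, hinit⟩⟩
  let enc : List (Symbol T g.NT) → Fin n := Function.invFun dec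
  have hdec (x) : dec x ∈ g.items := (e.symm x).2
  have henc {α} (h : α ∈ g.items) : dec (enc α) = α :=
    Function.invFun_eq ⟨e ⟨α, h⟩, by simp [dec]⟩
  let h : QuadraticGrammar T :=
    { NT := Fin n
      Choice := Fin m
      finite_NT := inferInstance
      finite_Choice := inferInstance
      body := fun x c => (g.itemBody (dec x) (e'.symm c)).map enc
      initial := enc [Symbol.nonterminal g.initial] }
  have sound (x : h.NT) (w : List T) (hw : h.Generates x w) : Yield g.Rel (dec x) w := by
    have key (x : h.NT) (c : h.Choice) (b) (hb : h.body x c = b) :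
        b = (g.itemBody (dec x) (e'.symm c)).map enc := hb.symm
    induction hw with
    | @eps x c hb =>
      have hb := key x c _ hb
      have hx := hdec x
      generalize dec x = α at hb hx
      generalize e'.symm c = r at hb
      revert hb
      fun_cases itemBody g α r <;> simp [QuadraticBody.map, Yield.nil, *]
    | @term x y c a w hb _ ih =>
      have hb := key x c _ hb
      have hx := hdec x
      generalize dec x = α at hb hx
      generalize e'.symm c = r at hb
      revert hb
      fun_cases itemBody g α r <;> simp [QuadraticBody.map, *]
      rintro rfl rfl
      rw [henc (g.items_tail hx)] at ih
      exact .terminal _ ih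
    | @pair x y z c v w hb _ _ ihv ihw =>
      have hb := key x c _ hb
      have hx := hdec x
      generalize dec x = α at hb hx
      generalize e'.symm c = r at hb
      revert hb
      fun_cases itemBody g α r <;> simp [QuadraticBody.map, *]
      rename_i r
      rintro rfl rfl
      rw [henc (g.items_tail hx)] at ihw
      rw [henc (.inr ⟨r.1, r.2, List.suffix_refl _⟩)] at ihv
      exact .nonterminal r.2 ihv ihw
  have complete (α : List (Symbol T g.NT)) (w : List T) (hw : Yield g.Rel α w) :
      α ∈ g.items → h.Generates (enc α) w := by
    have key (α) (hα : α ∈ g.items) (r) : h.body (enc α) (e' r) = (g.itemBody α r).map enc := by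
      simp [h, henc hα]
    induction hw with
    | nil => exact fun hα => .eps (key _ hα none)
    | terminal a _ ih => exact fun hα => .term (key _ hα none) (ih (g.items_tail hα))
    | @nonterminal A s u v w hr _ _ ihs ihu =>
      intro hα
      refine .pair ((key _ hα (some ⟨_, hr⟩)).trans ?_)
        (ihs (.inr ⟨_, hr, List.suffix_refl _⟩)) (ihu (g.items_tail hα))
      simp [itemBody, QuadraticBody.map]
  refine ⟨h, fun w => ?_⟩
  rw [g.mem_language_iff_yield]
  refine ⟨fun hw => ?_, fun hw => complete _ _ hw hinit⟩
  have := sound _ _ hw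
  rwa [henc hinit] at this

end ContextFreeGrammar

/-! ### Blocks of marked words -/

section MarkedWord

variable {T : Type*}

/-- The number of marked letters. -/
def markCount : List (T × Bool) → ℕ
  | [] => 0
  | (_, false) :: z => markCount z
  | (_, true) :: z => markCount z + 1

/-- The marked letters cut a word into blocks, each mark opening a new block; the blocks are
numbered consecutively, the one in front of the first mark having number `i`. Then
`markedBlock i z k` is the block with number `k`, and empty if there is none. -/
def markedBlock : ℕ → List (T × Bool) → ℕ → List T
  | _, [], _ => []
  | i, (a, false) :: z, k => (if k = i then [a] else []) ++ markedBlock i z k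
  | i, (a, true) :: z, k => (if k = i + 1 then [a] else []) ++ markedBlock (i + 1) z k

lemma markCount_append (y z : List (T × Bool)) :
    markCount (y ++ z) = markCount y + markCount z := by
  fun_induction markCount y <;> simp_all [markCount] <;> omega

/-- Absolute numbers of blocks turn concatenation of marked words into blockwise concatenation. -/
lemma markedBlock_append (i : ℕ) (y z : List (T × Bool)) (k : ℕ) :
    markedBlock i (y ++ z) k = markedBlock i y k ++ markedBlock (i + markCount y) z k := by
  fun_induction markCount y generalizing i with
  | case1 => simp [markedBlock]
  | case2 a z ih => simp [markedBlock, ih]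
  | case3 a z ih => simp [markedBlock, ih, Nat.add_assoc, Nat.add_comm 1]

lemma markedBlock_eq_nil {i : ℕ} {z : List (T × Bool)} {k : ℕ} (h : k < i ∨ i + markCount z < k) :
    markedBlock i z k = [] := by
  fun_induction markedBlock i z k with
  | case1 => rfl
  | case2 i a z k ih =>
    simp only [markCount] at h
    rw [ih h, if_neg (by omega)]; rfl
  | case3 i a z k ih =>
    simp only [markCount] at h
    rw [ih (by omega), if_neg (by omega)]; rfl

lemma markedBlock_ne_nil {i : ℕ} {z : List (T × Bool)} {k : ℕ} (h : i < k)
    (h' : k ≤ i + markCount z) : markedBlock i z k ≠ [] := by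
  fun_induction markedBlock i z k with
  | case1 => simp only [markCount] at h'; omega
  | case2 i a z k ih => simp only [markCount] at h'; simp [ih h h']
  | case3 i a z k ih =>
    simp only [markCount] at h'
    by_cases hk : k = i + 1
    · simp [hk]
    · simp [ih (by omega) (by omega)]

lemma markedBlock_of_markCount_eq_zero {i : ℕ} {z : List (T × Bool)} (h : markCount z = 0) :
    markedBlock i z i = z.map Prod.fst := by
  fun_induction markCount z <;> simp_all [markedBlock]

lemma markCount_map_false (w : List T) : markCount (w.map fun a => (a, false)) = 0 := by
  induction w with
  | nil => rfl
  | cons a w ih => exact ih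

/-- The blocks of a marked word concatenate to the word. -/
lemma flatMap_markedBlock (i : ℕ) (z : List (T × Bool)) :
    (List.range' i (markCount z + 1)).flatMap (markedBlock i z) = z.map Prod.fst := by
  -- The first letter occurs in no block with a larger number than its own.
  have tail (i j n : ℕ) (a : T) (b : Bool) (z : List (T × Bool)) (hj : i + b.toNat < j) :
      (List.range' j n).flatMap (markedBlock i ((a, b) :: z)) =
        (List.range' j n).flatMap (markedBlock (i + b.toNat) z) := by
    apply List.flatMap_congr
    intro k hk
    have := (List.mem_range'_1.1 hk).1
    cases b <;> simp only [Bool.toNat_false, Bool.toNat_true] at hj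
    · simp [markedBlock, show k ≠ i by omega]
    · simp [markedBlock, show k ≠ i + 1 by omega]
  fun_induction markCount z generalizing i with
  | case1 => simp [markedBlock]
  | case2 a z ih =>
    have := ih i
    rw [List.range'_succ, List.flatMap_cons] at this ⊢
    rw [tail _ _ _ _ _ _ (by simp)]
    simpa [markedBlock] using this
  | case3 a z ih =>
    have := ih (i + 1)
    rw [List.range'_succ, List.flatMap_cons] at this ⊢
    rw [List.range'_succ, List.flatMap_cons, tail _ _ _ _ _ _ (by simp)]
    simpa [markedBlock, markedBlock_eq_nil (i := i + 1) (k := i) (z := z) (by omega)] using this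

/-- A concatenation of nonempty words, marked at the first letter of each of them. -/
def markStarts (ws : List (List T)) : List (T × Bool) :=
  ws.flatMap fun
    | [] => []
    | a :: w => (a, true) :: w.map fun a => (a, false)

lemma map_fst_markStarts (ws : List (List T)) : (markStarts ws).map Prod.fst = ws.flatten := by
  induction ws with
  | nil => rfl
  | cons w ws ih =>
    rw [markStarts, List.flatMap_cons, List.map_append, ← markStarts, ih]
    cases w <;> simp [Function.comp_def]

lemma markCount_markStarts {ws : List (List T)} (h : ∀ w ∈ ws, w ≠ []) :
    markCount (markStarts ws) = ws.length := by
  induction ws with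
  | nil => rfl
  | cons w ws ih =>
    rw [markStarts, List.flatMap_cons, markCount_append, ← markStarts, ih (by simp_all)]
    cases w
    · simp at h
    · simp [markCount, markCount_map_false, Nat.add_comm]

lemma markedBlock_markStarts_self {ws : List (List T)} (h : ∀ w ∈ ws, w ≠ []) (i : ℕ) :
    markedBlock i (markStarts ws) i = [] := by
  obtain _ | ⟨_ | ⟨a, w⟩, ws⟩ := ws
  · rfl
  · simp at h
  · simp [markStarts, markedBlock, markedBlock_eq_nil]

lemma markedBlock_markStarts {ws : List (List T)} (h : ∀ w ∈ ws, w ≠ []) (i t : ℕ)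
    (ht : t < ws.length) : markedBlock i (markStarts ws) (i + t + 1) = ws[t] := by
  induction ws generalizing i t with
  | nil => simp at ht
  | cons w ws ih =>
    rw [markStarts, List.flatMap_cons, markedBlock_append, ← markStarts]
    obtain _ | ⟨a, w⟩ := w
    · simp at h
    have hc := markCount_map_false w
    simp only [markCount, hc, markedBlock]
    cases t with
    | zero =>
      rw [Nat.add_zero, markedBlock_markStarts_self (by simp_all),
        markedBlock_of_markCount_eq_zero hc]
      simp [Function.comp_def]
    | succ t =>
      rw [if_neg (by omega), markedBlock_eq_nil (z := w.map _) (by omega)]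
      have := ih (by simp_all) (i + 1) t (by simpa using ht)
      simpa [Nat.add_assoc, Nat.add_comm, Nat.add_left_comm] using this

end MarkedWord

/-! ### The indexed grammar of the blocks -/

section BlockGrammar

variable {T : Type*}

/-- Nonterminals of the block grammar. Marks are numbered from `0` and blocks from `0` to `ℓ`, block
`k` lying between the marks `k - 1` and `k`. The nonterminal `some (x, i, j, k)` generates block `k`
of a word that is generated by `x` and carries the marks `i, …, j - 1`; it consists of the blocks
`i, …, j`. The start symbol is `none`. -/
abbrev BlockNT (g : QuadraticGrammar T) (ℓ : ℕ) : Type :=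
  Option (g.NT × Fin (ℓ + 1) × Fin (ℓ + 1) × Fin (ℓ + 1))

/-- Flags of the block grammar. The flag `(c, i, m, j)` says that the nonterminal with the marks
`i, …, j - 1` is expanded by its rule with label `c`, and that the marks `m, …, j - 1` are those
in the part generated by the last symbol of the rule. -/
abbrev BlockFlag (g : QuadraticGrammar T) (ℓ : ℕ) : Type :=
  g.Choice × Fin (ℓ + 1) × Fin (ℓ + 1) × Fin (ℓ + 1)

variable (g : QuadraticGrammar T) {ℓ : ℕ}

/-- The nonterminal for block `k` of `x` with marks `i, …, j - 1`, as a symbol. -/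
def blockSymbol (x : g.NT) (i j k : Fin (ℓ + 1)) : Symbol T (BlockNT g ℓ) :=
  Symbol.nonterminal (some (x, i, j, k))

/-- The replacement for `some (x, i, j, k)` upon consuming a flag. A flag meant for other marks
than `i, …, j - 1`, or not applicable to `x`, is skipped. -/
def popString (x : g.NT) (i j k : Fin (ℓ + 1)) :
    BlockFlag g ℓ → List (Symbol T (BlockNT g ℓ))
  | (c, i', m, j') =>
    if i' = i ∧ j' = j then
      match g.body x c with
      | .term a y =>
        -- The terminal `a` either is unmarked or carries the mark `i`.
        if m = i ∨ (m : ℕ) = i + 1 then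
          (if k = m then [Symbol.terminal a] else []) ++ [blockSymbol g y m j k]
        else [blockSymbol g x i j k]
      | .pair y z =>
        if i ≤ m ∧ m ≤ j then [blockSymbol g y i m k, blockSymbol g z m j k]
        else [blockSymbol g x i j k]
      | _ => [blockSymbol g x i j k]
    else [blockSymbol g x i j k]

/-- The rule of `x` with label `c` as a rule for words without marks. A missing rule is replaced by
the trivial rule. -/
def plainString (x : g.NT) (i : Fin (ℓ + 1)) (c : g.Choice) : List (Symbol T (BlockNT g ℓ)) :=
  match g.body x c with
  | .stuck => [blockSymbol g x i i i]
  | .eps => []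
  | .term a y => [Symbol.terminal a, blockSymbol g y i i i]
  | .pair y z => [blockSymbol g y i i i, blockSymbol g z i i i]

/-- The productions of the block grammar. -/
inductive IsBlockProduction (s : List (Symbol T (BlockNT g ℓ))) :
    IndexedProduction T (BlockNT g ℓ) (BlockFlag g ℓ) → Prop
  | push (f : BlockFlag g ℓ) : IsBlockProduction s (.push none none f)
  | start : IsBlockProduction s (.plain none s)
  | out (x : g.NT) (i j k : Fin (ℓ + 1)) (h : k < i ∨ j < k) :
      IsBlockProduction s (.plain (some (x, i, j, k)) [])
  | plain (x : g.NT) (i : Fin (ℓ + 1)) (c : g.Choice) :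
      IsBlockProduction s (.plain (some (x, i, i, i)) (plainString g x i c))
  | pop (x : g.NT) (i j k : Fin (ℓ + 1)) (f : BlockFlag g ℓ) (h : i < j) (hk : i ≤ k ∧ k ≤ j) :
      IsBlockProduction s (.pop (some (x, i, j, k)) f (popString g x i j k f))

lemma finite_isBlockProduction (s : List (Symbol T (BlockNT g ℓ))) :
    {p | IsBlockProduction g s p}.Finite := by
  let F : BlockFlag g ℓ ⊕ Unit ⊕ (g.NT × Fin (ℓ + 1) × Fin (ℓ + 1) × Fin (ℓ + 1)) ⊕
      (g.NT × Fin (ℓ + 1) × g.Choice) ⊕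
      ((g.NT × Fin (ℓ + 1) × Fin (ℓ + 1) × Fin (ℓ + 1)) × BlockFlag g ℓ) →
      IndexedProduction T (BlockNT g ℓ) (BlockFlag g ℓ) :=
    Sum.elim (fun f => .push none none f) <| Sum.elim (fun _ => .plain none s) <|
      Sum.elim (fun q => .plain (some q) []) <|
      Sum.elim (fun q => .plain (some (q.1, q.2.1, q.2.1, q.2.1)) (plainString g q.1 q.2.1 q.2.2))
      (fun q => .pop (some q.1) q.2 (popString g q.1.1 q.1.2.1 q.1.2.2.1 q.1.2.2.2 q.2))
  refine (Set.finite_range F).subset ?_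
  rintro _ (f | _ | ⟨x, i, j, k, h⟩ | ⟨x, i, c⟩ | ⟨x, i, j, k, f, h, hk⟩)
  · exact ⟨.inl f, rfl⟩
  · exact ⟨.inr (.inl ()), rfl⟩
  · exact ⟨.inr (.inr (.inl (x, i, j, k))), rfl⟩
  · exact ⟨.inr (.inr (.inr (.inl (x, i, c)))), rfl⟩
  · exact ⟨.inr (.inr (.inr (.inr ((x, i, j, k), f)))), rfl⟩

/-- The indexed grammar that guesses a flag word and then generates, from each nonterminal of the
string `s`, the block of a marked word that the flag word prescribes. -/
noncomputable abbrev blockGrammar (s : List (Symbol T (BlockNT g ℓ))) : IndexedGrammar T where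
  NT := BlockNT g ℓ
  Flag := BlockFlag g ℓ
  initial := none
  productions := (finite_isBlockProduction g s).toFinset

/-- The flagged string `u` yields the word `w` in the block grammar. -/
def BlockYield (s : List (Symbol T (BlockNT g ℓ))) (γ : List (BlockFlag g ℓ))
    (u : List (Symbol T (BlockNT g ℓ))) (w : List T) : Prop :=
  Yield (blockGrammar g s).Rel (attachFlag γ u) w

variable {g} {s : List (Symbol T (BlockNT g ℓ))} {γ : List (BlockFlag g ℓ)} {w : List T}

lemma blockYield_pair_iff {a b : Symbol T (BlockNT g ℓ)} :
    BlockYield g s γ [a, b] w ↔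
      ∃ w₁ w₂, w = w₁ ++ w₂ ∧ BlockYield g s γ [a] w₁ ∧ BlockYield g s γ [b] w₂ :=
  Yield.pair_iff

lemma blockYield_terminal_iff {a : T} {u : List (Symbol T (BlockNT g ℓ))} :
    BlockYield g s γ (Symbol.terminal a :: u) w ↔ ∃ w', w = a :: w' ∧ BlockYield g s γ u w' :=
  Yield.terminal_iff

lemma blockGrammar_rel_none_iff {t : List (Symbol T (BlockNT g ℓ × List (BlockFlag g ℓ)))} :
    (blockGrammar g s).Rel (none, γ) t ↔
      (∃ f, t = [Symbol.nonterminal (none, f :: γ)]) ∨ t = attachFlag γ s := by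
  constructor
  · rintro ⟨p, hp, he⟩
    replace hp : IsBlockProduction g s p := (Set.Finite.mem_toFinset _).1 hp
    cases hp <;> cases he
    · exact .inl ⟨_, rfl⟩
    · exact .inr rfl
  · rintro (⟨f, rfl⟩ | rfl)
    · exact ⟨_, (Set.Finite.mem_toFinset _).2 (.push f), .push none none f γ⟩
    · exact ⟨_, (Set.Finite.mem_toFinset _).2 .start, .plain none s γ⟩

lemma blockGrammar_rel_some_iff {x : g.NT} {i j k : Fin (ℓ + 1)}
    {t : List (Symbol T (BlockNT g ℓ × List (BlockFlag g ℓ)))} :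
    (blockGrammar g s).Rel (some (x, i, j, k), γ) t ↔
      ((k < i ∨ j < k) ∧ t = []) ∨
      (j = i ∧ k = i ∧ ∃ c, t = attachFlag γ (plainString g x i c)) ∨
      (i < j ∧ i ≤ k ∧ k ≤ j ∧ ∃ f δ, γ = f :: δ ∧ t = attachFlag δ (popString g x i j k f)) := by
  constructor
  · rintro ⟨p, hp, he⟩
    replace hp : IsBlockProduction g s p := (Set.Finite.mem_toFinset _).1 hp
    cases hp <;> cases he
    · exact .inl ⟨‹_›, rfl⟩
    · exact .inr (.inl ⟨rfl, rfl, _, rfl⟩)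
    · exact .inr (.inr ⟨‹_›, And.left ‹_ ∧ _›, And.right ‹_ ∧ _›, _, _, rfl, rfl⟩)
  · rintro (⟨h, rfl⟩ | ⟨rfl, rfl, c, rfl⟩ | ⟨h, h₁, h₂, f, δ, rfl, rfl⟩)
    · exact ⟨_, (Set.Finite.mem_toFinset _).2 (IsBlockProduction.out x i j k h), .plain _ [] γ⟩
    · exact ⟨_, (Set.Finite.mem_toFinset _).2 (.plain x k c), .plain _ _ γ⟩
    · exact ⟨_, (Set.Finite.mem_toFinset _).2 (.pop x i j k f h ⟨h₁, h₂⟩), .pop _ _ _ δ⟩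

lemma blockYield_singleton_iff {x : g.NT} {i j k : Fin (ℓ + 1)} :
    BlockYield g s γ [blockSymbol g x i j k] w ↔
      ((k < i ∨ j < k) ∧ w = []) ∨
      (j = i ∧ k = i ∧ ∃ c, BlockYield g s γ (plainString g x i c) w) ∨
      (i < j ∧ i ≤ k ∧ k ≤ j ∧ ∃ f δ, γ = f :: δ ∧ BlockYield g s δ (popString g x i j k f) w) := by
  refine Yield.singleton_iff.trans ⟨?_, ?_⟩
  · rintro ⟨t, hr, ht⟩
    rcases blockGrammar_rel_some_iff.1 hr with
      (⟨h, rfl⟩ | ⟨hj, hk, c, rfl⟩ | ⟨h, h₁, h₂, f, δ, hf, rfl⟩)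
    · exact .inl ⟨h, Yield.nil_iff.1 ht⟩
    · exact .inr (.inl ⟨hj, hk, c, ht⟩)
    · exact .inr (.inr ⟨h, h₁, h₂, f, δ, hf, ht⟩)
  · rintro (⟨h, rfl⟩ | ⟨hj, hk, c, hc⟩ | ⟨h, h₁, h₂, f, δ, hf, ht⟩)
    · exact ⟨_, blockGrammar_rel_some_iff.2 (.inl ⟨h, rfl⟩), .nil⟩
    · exact ⟨_, blockGrammar_rel_some_iff.2 (.inr (.inl ⟨hj, hk, c, rfl⟩)), hc⟩
    · exact ⟨_, blockGrammar_rel_some_iff.2 (.inr (.inr ⟨h, h₁, h₂, f, δ, hf, rfl⟩)), ht⟩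

lemma blockYield_out_iff {x : g.NT} {i j k : Fin (ℓ + 1)} (hk : k < i ∨ j < k) :
    BlockYield g s γ [blockSymbol g x i j k] w ↔ w = [] := by
  rw [blockYield_singleton_iff]
  constructor
  · rintro (⟨-, h⟩ | ⟨hj, hi, -⟩ | ⟨-, h₁, h₂, -⟩)
    · exact h
    · simp [hj, hi] at hk
    · exact absurd hk (by simp [h₁, h₂])
  · exact fun h => .inl ⟨hk, h⟩

/-- The effect of a flag does not depend on the number of the block: all the nonterminals with the
same `x`, `i`, `j` perform the same step of the derivation. -/
lemma popString_cases (x : g.NT) {i j : Fin (ℓ + 1)} (hij : i < j) (f : BlockFlag g ℓ) :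
    (∀ k, popString g x i j k f = [blockSymbol g x i j k]) ∨
    (∃ c a y m, g.body x c = .term a y ∧ (m = i ∨ (m : ℕ) = i + 1) ∧ i ≤ m ∧ m ≤ j ∧
      ∀ k, popString g x i j k f =
        (if k = m then [Symbol.terminal a] else []) ++ [blockSymbol g y m j k]) ∨
    (∃ c y z m, g.body x c = .pair y z ∧ i ≤ m ∧ m ≤ j ∧
      ∀ k, popString g x i j k f = [blockSymbol g y i m k, blockSymbol g z m j k]) := by
  obtain ⟨c, i', m, j'⟩ := f
  unfold popString
  by_cases h : i' = i ∧ j' = j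
  · simp only [if_pos h]
    cases hb : g.body x c with
    | stuck => exact .inl fun _ => rfl
    | eps => exact .inl fun _ => rfl
    | term a y =>
      by_cases hm : m = i ∨ (m : ℕ) = i + 1
      · simp only [if_pos hm]
        refine .inr (.inl ⟨c, a, y, m, hb, hm, ?_, ?_, fun _ => rfl⟩) <;>
        · simp only [Fin.le_def, Fin.lt_def, Fin.ext_iff] at *; omega
      · simp only [if_neg hm]
        exact .inl fun _ => trivial
    | pair y z =>
      by_cases hm : i ≤ m ∧ m ≤ j
      · simp only [if_pos hm]
        exact .inr (.inr ⟨c, y, z, m, hb, hm.1, hm.2, fun _ => rfl⟩)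
      · simp only [if_neg hm]
        exact .inl fun _ => trivial
  · simp only [if_neg h]
    exact .inl fun _ => trivial

lemma blockYield_popString_out_iff {x : g.NT} {i j k : Fin (ℓ + 1)} (hij : i < j)
    (hk : k < i ∨ j < k) (f : BlockFlag g ℓ) :
    BlockYield g s γ (popString g x i j k f) w ↔ w = [] := by
  rcases popString_cases x hij f with
    h | ⟨c, a, y, m, -, -, hi, hj, h⟩ | ⟨c, y, z, m, -, hi, hj, h⟩ <;> rw [h]
  · exact blockYield_out_iff hk
  · have hk' : k < m ∨ j < k := hk.imp_left hi.trans_lt'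
    have hkm : k ≠ m := by
      rintro rfl
      exact hk'.elim (lt_irrefl _) hj.not_gt
    rw [if_neg hkm]
    exact blockYield_out_iff hk'
  · rw [blockYield_pair_iff]
    simp only [blockYield_out_iff (i := i) (hk.imp_right hj.trans_lt),
      blockYield_out_iff (j := j) (hk.imp_left hi.trans_lt')]
    simp

lemma blockYield_cons_iff {x : g.NT} {i j : Fin (ℓ + 1)} (hij : i < j) (k : Fin (ℓ + 1))
    (f : BlockFlag g ℓ) :
    BlockYield g s (f :: γ) [blockSymbol g x i j k] w ↔
      BlockYield g s γ (popString g x i j k f) w := by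
  by_cases hk : k < i ∨ j < k
  · rw [blockYield_out_iff hk, blockYield_popString_out_iff hij hk]
  · rw [blockYield_singleton_iff]
    push Not at hk
    constructor
    · rintro (⟨h, -⟩ | ⟨h, -⟩ | ⟨-, -, -, f, δ, h, hf⟩)
      · exact absurd h (by simpa using hk)
      · exact absurd h hij.ne'
      · cases h; exact hf
    · exact fun h => .inr (.inr ⟨hij, hk.1, hk.2, f, γ, rfl, h⟩)

lemma not_blockYield_nil {x : g.NT} {i j : Fin (ℓ + 1)} (hij : i < j) :
    ¬ BlockYield g s [] [blockSymbol g x i j i] w := by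
  rw [blockYield_singleton_iff]
  rintro (⟨h, -⟩ | ⟨h, -⟩ | ⟨-, -, -, f, δ, h, hf⟩)
  · simp [hij.not_gt] at h
  · exact hij.ne' h
  · simp at h

/-- Nonterminals without marks work like those of the context-free grammar, whatever their flag
word. -/
lemma blockYield_plain_iff {x : g.NT} {i : Fin (ℓ + 1)} :
    BlockYield g s γ [blockSymbol g x i i i] w ↔ g.Generates x w := by
  constructor
  · -- The right-hand sides have one of the three forms below, which makes the induction work.
    suffices H : ∀ u w, Yield (blockGrammar g s).Rel u w →
        (∀ x, u = attachFlag γ [blockSymbol g x i i i] → g.Generates x w) ∧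
        (∀ a y, u = attachFlag γ [Symbol.terminal a, blockSymbol g y i i i] →
          ∃ w', w = a :: w' ∧ g.Generates y w') ∧
        (∀ y z, u = attachFlag γ [blockSymbol g y i i i, blockSymbol g z i i i] →
          ∃ w₁ w₂, w = w₁ ++ w₂ ∧ g.Generates y w₁ ∧ g.Generates z w₂) from
      fun h => (H _ _ h).1 x rfl
    intro u w h
    induction h with
    | nil => simp [blockSymbol]
    | @terminal a u w h ih =>
      refine ⟨by simp [blockSymbol], ?_, by simp [blockSymbol]⟩
      rintro b y hu
      simp only [attachFlag_terminal, List.cons.injEq, Symbol.terminal.injEq] at hu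
      obtain ⟨rfl, hu⟩ := hu
      exact ⟨w, rfl, ih.1 y hu⟩
    | @nonterminal A t u v w hr ht hu iht ihu =>
      -- The word generated by the first symbol, which is the first component if there is no other.
      have head (x : g.NT) (hA : A = (some (x, i, i, i), γ)) : g.Generates x v := by
        subst hA
        rcases blockGrammar_rel_some_iff.1 hr with (⟨h, -⟩ | ⟨-, -, c, rfl⟩ | ⟨h, -⟩)
        · simp at h
        · cases hb : g.body x c <;> simp only [plainString, hb] at iht ht
          · exact iht.1 x rfl
          · rw [Yield.nil_iff.1 ht]
            exact .eps hb
          · obtain ⟨w', rfl, h⟩ := iht.2.1 _ _ rfl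
            exact .term hb h
          · obtain ⟨w₁, w₂, rfl, h₁, h₂⟩ := iht.2.2 _ _ rfl
            exact .pair hb h₁ h₂
        · simp at h
      refine ⟨?_, by simp [blockSymbol], ?_⟩
      · intro x hx
        simp only [blockSymbol, attachFlag_nonterminal, attachFlag_nil, List.cons.injEq,
          Symbol.nonterminal.injEq] at hx
        obtain ⟨hA, rfl⟩ := hx
        rw [Yield.nil_iff.1 hu, List.append_nil]
        exact head x hA
      · intro y z hx
        simp only [blockSymbol, attachFlag_nonterminal, attachFlag_nil, List.cons.injEq,
          Symbol.nonterminal.injEq] at hx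
        exact ⟨v, w, rfl, head y hx.1, ihu.1 z hx.2⟩
  · intro h
    induction h with
    | @eps x c hb =>
      refine blockYield_singleton_iff.2 (.inr (.inl ⟨rfl, rfl, c, ?_⟩))
      rw [plainString, hb]
      exact .nil
    | @term x y c a w hb _ ih =>
      refine blockYield_singleton_iff.2 (.inr (.inl ⟨rfl, rfl, c, ?_⟩))
      rw [plainString, hb]
      exact .terminal _ ih
    | @pair x y z c v w hb _ _ ih₁ ih₂ =>
      refine blockYield_singleton_iff.2 (.inr (.inl ⟨rfl, rfl, c, ?_⟩))
      rw [plainString, hb]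
      exact blockYield_pair_iff.2 ⟨_, _, rfl, ih₁, ih₂⟩

/-- Since the flag word is guessed first, the language of the block grammar is the union over all
flag words of the languages generated by the string `s`. -/
lemma mem_language_blockGrammar_iff :
    w ∈ (blockGrammar g s).language ↔ ∃ γ, BlockYield g s γ s w := by
  rw [IndexedGrammar.mem_language_iff_yield]
  constructor
  · suffices H : ∀ u w, Yield (blockGrammar g s).Rel u w →
        ∀ γ, u = [Symbol.nonterminal (none, γ)] → ∃ γ, BlockYield g s γ s w from
      fun h => H _ _ h [] rfl
    intro u w h
    induction h with
    | nil => simp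
    | terminal => simp
    | nonterminal hr ht hu iht _ =>
      intro γ hγ
      obtain ⟨rfl, rfl⟩ := by simpa using hγ
      rw [Yield.nil_iff.1 hu, List.append_nil]
      rcases blockGrammar_rel_none_iff.1 hr with (⟨f, rfl⟩ | rfl)
      · exact iht _ rfl
      · exact ⟨γ, ht⟩
  · rintro ⟨γ, h⟩
    replace h : Yield (blockGrammar g s).Rel [Symbol.nonterminal (none, γ)] w :=
      Yield.singleton_iff.2 ⟨_, blockGrammar_rel_none_iff.2 (.inr rfl), h⟩
    induction γ with
    | nil => exact h
    | cons f γ ih =>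
      exact ih (Yield.singleton_iff.2 ⟨_, blockGrammar_rel_none_iff.2 (.inl ⟨f, rfl⟩), h⟩)

/-- The pieces generated with a common flag word are the blocks of one marked word: all copies of
the flag word describe the same part of a derivation tree. -/
theorem exists_markedWord_of_blockYield (x : g.NT) (i j : Fin (ℓ + 1)) (hij : i ≤ j)
    (w : Fin (ℓ + 1) → List T) (h : ∀ k, BlockYield g s γ [blockSymbol g x i j k] (w k)) :
    ∃ z, g.Generates x (z.map Prod.fst) ∧ (i : ℕ) + markCount z = j ∧
      ∀ k : Fin (ℓ + 1), w k = markedBlock i z k := by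
  -- Without marks the flag word is irrelevant, and there is a single block.
  have base (γ : List (BlockFlag g ℓ)) (x : g.NT) (i : Fin (ℓ + 1)) (w : Fin (ℓ + 1) → List T)
      (h : ∀ k, BlockYield g s γ [blockSymbol g x i i k] (w k)) :
      ∃ z, g.Generates x (z.map Prod.fst) ∧ (i : ℕ) + markCount z = i ∧
        ∀ k : Fin (ℓ + 1), w k = markedBlock i z k := by
    have hc := markCount_map_false (w i)
    refine ⟨(w i).map fun a => (a, false), ?_, by rw [hc, Nat.add_zero], fun k => ?_⟩
    · simpa [Function.comp_def] using blockYield_plain_iff.1 (h i)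
    · rcases lt_trichotomy k i with hk | rfl | hk
      · rw [markedBlock_eq_nil (.inl hk)]
        exact (blockYield_out_iff (.inl hk)).1 (h k)
      · simp [markedBlock_of_markCount_eq_zero hc, Function.comp_def]
      · rw [markedBlock_eq_nil (.inr (by rwa [hc]))]
        exact (blockYield_out_iff (.inr hk)).1 (h k)
  induction γ generalizing x i j w with
  | nil =>
    rcases hij.eq_or_lt with rfl | hij
    · exact base _ x i w h
    · exact absurd (h i) (not_blockYield_nil hij)
  | cons f γ ih =>
    rcases hij.eq_or_lt with rfl | hij
    · exact base _ x i w h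
    replace h k := (blockYield_cons_iff hij k f).1 (h k)
    rcases popString_cases x hij f with
      hf | ⟨c, a, y, m, hb, hm, -, hmj, hf⟩ | ⟨c, y, z, m, hb, him, hmj, hf⟩ <;> simp only [hf] at h
    · exact ih x i j hij.le w h
    · have h' (k : Fin (ℓ + 1)) : ∃ v, w k = (if k = m then [a] else []) ++ v ∧
          BlockYield g s γ [blockSymbol g y m j k] v := by
        have := h k
        split_ifs at this ⊢ with hk
        · exact blockYield_terminal_iff.1 this
        · exact ⟨_, rfl, this⟩
      choose v hv hv' using h'
      obtain ⟨z, hz, hc, hz'⟩ := ih y m j hmj v hv'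
      rcases hm with rfl | hm
      · exact ⟨(a, false) :: z, .term hb hz, hc, fun k => by
          simp [hv, markedBlock, hz', Fin.ext_iff]⟩
      · exact ⟨(a, true) :: z, .term hb hz, by simp only [markCount]; omega, fun k => by
          simp [hv, markedBlock, hz', Fin.ext_iff, hm]⟩
    · choose u v huv hu hv using fun k => blockYield_pair_iff.1 (h k)
      obtain ⟨p, hp, hpc, hpb⟩ := ih y i m him u hu
      obtain ⟨q, hq, hqc, hqb⟩ := ih z m j hmj v hv
      refine ⟨p ++ q, ?_, by rw [markCount_append]; omega, fun k => ?_⟩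
      · rw [List.map_append]
        exact .pair hb hp hq
      · rw [huv, hpb, hqb, markedBlock_append, hpc]

/-- A nonterminal skips all flags that are meant for other marks. -/
lemma blockYield_append_of_skip {x : g.NT} {i j k : Fin (ℓ + 1)} (hij : i < j)
    {δ : List (BlockFlag g ℓ)} (hδ : ∀ f ∈ δ, ¬ (f.2.1 = i ∧ f.2.2.2 = j))
    (h : BlockYield g s γ [blockSymbol g x i j k] w) :
    BlockYield g s (δ ++ γ) [blockSymbol g x i j k] w := by
  induction δ with
  | nil => exact h
  | cons f δ ih =>
    rw [List.cons_append, blockYield_cons_iff hij, popString, if_neg (hδ f (by simp))]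
    exact ih fun f hf => hδ f (by simp [hf])

lemma blockYield_of_markCount_eq_zero {x : g.NT} {z : List (T × Bool)}
    (hz : g.Generates x (z.map Prod.fst)) (h : markCount z = 0) (i k : Fin (ℓ + 1)) :
    BlockYield g s γ [blockSymbol g x i i k] (markedBlock i z k) := by
  rcases lt_trichotomy k i with hk | rfl | hk
  · exact (blockYield_out_iff (.inl hk)).2 (markedBlock_eq_nil (.inl hk))
  · rw [markedBlock_of_markCount_eq_zero h]
    exact blockYield_plain_iff.2 hz
  · exact (blockYield_out_iff (.inr hk)).2 (markedBlock_eq_nil (.inr (by rwa [h])))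

/-- For every marked word there is a flag word from which its blocks are generated. The flags
concern subintervals of the marks of the word only, so that two such flag words for adjacent
intervals can be concatenated. -/
theorem exists_flags_of_generates {x : g.NT} {v : List T} (hv : g.Generates x v)
    (z : List (T × Bool)) (hz : z.map Prod.fst = v) (i j : Fin (ℓ + 1))
    (hij : (i : ℕ) + markCount z = j) :
    ∃ γ : List (BlockFlag g ℓ), (∀ f ∈ γ, i ≤ f.2.1 ∧ f.2.1 < f.2.2.2 ∧ f.2.2.2 ≤ j) ∧
      ∀ (δ : List (BlockFlag g ℓ)) (k : Fin (ℓ + 1)),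
        BlockYield g s (γ ++ δ) [blockSymbol g x i j k] (markedBlock i z k) := by
  -- Without marks no flags are needed.
  have base {x : g.NT} {v : List T} (hv : g.Generates x v)
      (z : List (T × Bool)) (hz : z.map Prod.fst = v) (i j : Fin (ℓ + 1))
      (hij : (i : ℕ) + markCount z = j) (h : i = j) :
      ∃ γ : List (BlockFlag g ℓ), (∀ f ∈ γ, i ≤ f.2.1 ∧ f.2.1 < f.2.2.2 ∧ f.2.2.2 ≤ j) ∧
        ∀ (δ : List (BlockFlag g ℓ)) (k : Fin (ℓ + 1)),
          BlockYield g s (γ ++ δ) [blockSymbol g x i j k] (markedBlock i z k) := by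
    subst h hz
    exact ⟨[], by simp, fun δ k => blockYield_of_markCount_eq_zero hv (by omega) i k⟩
  induction hv generalizing z i j with
  | eps hb =>
    obtain rfl := List.map_eq_nil_iff.1 hz
    exact base (.eps hb) [] rfl i j hij (Fin.ext hij)
  | @term x y c a w hb hw ih =>
    obtain ⟨⟨a, b⟩, z, rfl, rfl, rfl⟩ := List.map_eq_cons_iff.1 hz
    by_cases h : i = j
    · exact base (.term hb hw) _ rfl i j hij h
    have hlt : i < j := lt_of_le_of_ne (Fin.le_def.2 (by omega)) h
    obtain ⟨m, hm, hmj, hblk⟩ : ∃ m : Fin (ℓ + 1), (m = i ∨ (m : ℕ) = i + 1) ∧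
        (m : ℕ) + markCount z = j ∧ ∀ k : Fin (ℓ + 1), markedBlock i ((a, b) :: z) k =
          (if k = m then [a] else []) ++ markedBlock m z k := by
      cases b with
      | false => exact ⟨i, .inl rfl, hij, fun k => by simp [markedBlock, Fin.ext_iff]⟩
      | true =>
        have hlt' : (i : ℕ) + 1 < ℓ + 1 := lt_of_le_of_lt (Nat.succ_le_of_lt hlt) j.2
        refine ⟨⟨i + 1, hlt'⟩, .inr rfl, ?_, fun k => by simp [markedBlock, Fin.ext_iff]⟩
        simp only [markCount] at hij ⊢; omega
    have him : i ≤ m := Fin.le_def.2 (by rcases hm with rfl | hm <;> omega)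
    obtain ⟨γ, hγ, hy⟩ := ih z rfl m j hmj
    refine ⟨(c, i, m, j) :: γ, ?_, fun δ k => ?_⟩
    · rintro f (_ | ⟨_, hf⟩)
      · exact ⟨le_rfl, hlt, le_rfl⟩
      · exact ⟨him.trans (hγ f hf).1, (hγ f hf).2⟩
    · rw [List.cons_append, blockYield_cons_iff hlt]
      simp only [popString, true_and, if_true, hb, if_pos hm, hblk]
      split_ifs
      · exact .terminal _ (hy δ k)
      · exact hy δ k
  | @pair x y y' c w w' hb hw hw' ih ih' =>
    obtain ⟨z, z', rfl, rfl, rfl⟩ := List.map_eq_append_iff.1 hz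
    by_cases h : i = j
    · exact base (.pair hb hw hw') _ hz i j hij h
    have hlt : i < j := lt_of_le_of_ne (Fin.le_def.2 (by omega)) h
    rw [markCount_append] at hij
    let m : Fin (ℓ + 1) := ⟨i + markCount z, by omega⟩
    have him : i ≤ m := Fin.le_def.2 (by simp [m])
    have hmj : m ≤ j := Fin.le_def.2 (by simp only [m]; omega)
    obtain ⟨γ, hγ, hy⟩ := ih z rfl i m rfl
    obtain ⟨γ', hγ', hy'⟩ := ih' z' rfl m j (by simp only [m]; omega)
    refine ⟨(c, i, m, j) :: (γ ++ γ'), ?_, fun δ k => ?_⟩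
    · rintro f (_ | ⟨_, hf⟩)
      · exact ⟨le_rfl, hlt, le_rfl⟩
      rcases List.mem_append.1 hf with hf | hf
      · exact ⟨(hγ f hf).1, (hγ f hf).2.1, (hγ f hf).2.2.trans hmj⟩
      · exact ⟨him.trans (hγ' f hf).1, (hγ' f hf).2⟩
    · rw [List.cons_append, blockYield_cons_iff hlt]
      simp only [popString, true_and, if_true, hb, if_pos (And.intro him hmj), markedBlock_append]
      refine blockYield_pair_iff.2 ⟨_, _, rfl, ?_, ?_⟩
      · rw [List.append_assoc]
        exact hy _ k
      -- The second factor either has no marks or skips the flags of the first.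
      · rw [List.append_assoc]
        rcases hmj.eq_or_lt with hmj | hmj
        · have hz' : markCount z' = 0 := by
            have := congrArg Fin.val hmj
            simp only [m] at this; omega
          have := blockYield_of_markCount_eq_zero (s := s) (γ := γ ++ (γ' ++ δ)) hw' hz' m k
          change BlockYield g s _ _ (markedBlock m z' k)
          rwa [hmj] at this ⊢
        · refine blockYield_append_of_skip hmj (fun f hf hfm => ?_) (hy' δ k)
          have := hγ f hf
          rw [hfm.1] at this
          exact absurd (this.2.1.trans_le this.2.2) (lt_irrefl _)

end BlockGrammar

/-! ### Permuted subwords -/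

section Permutation

variable {T : Type*}

/-- The string whose `t`-th part generates the `t`-th of `n + 1` nonempty subwords. Subword `0`
consists of the blocks `0` and `1`, the former being the part in front of the first mark; every other
subword `t` is the block `t + 1`. -/
def subwordString (g : QuadraticGrammar T) (n : ℕ) :
    Fin (n + 1) → List (Symbol T (BlockNT g (n + 1))) :=
  Fin.cons [blockSymbol g g.initial 0 (Fin.last _) 0, blockSymbol g g.initial 0 (Fin.last _) 1]
    fun t => [blockSymbol g g.initial 0 (Fin.last _) t.succ.succ]

lemma flatten_ofFn_markedBlock {n : ℕ} {z : List (T × Bool)} (h : markCount z = n + 1) :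
    (List.ofFn (Fin.cons (markedBlock 0 z 0 ++ markedBlock 0 z 1)
      fun t : Fin n => markedBlock 0 z (t + 2))).flatten = z.map Prod.fst := by
  rw [← flatMap_markedBlock 0 z, h, List.range'_succ, List.range'_succ]
  have : List.range' (0 + 1 + 1) n = List.ofFn fun t : Fin n => (t : ℕ) + 2 := by
    apply List.ext_getElem <;> simp [Nat.add_comm]
  simp [this, List.ofFn_succ, List.flatMap_def, List.map_ofFn, Function.comp_def]

/-- The indexed grammar whose initial string is the string of all subwords in permuted order. -/
noncomputable def permutationGrammar (g : QuadraticGrammar T) {n : ℕ}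
    (τ : Equiv.Perm (Fin (n + 1))) : IndexedGrammar T :=
  blockGrammar g (List.ofFn fun i => subwordString g n (τ i)).flatten

lemma blockYield_flatten_ofFn_iff {g : QuadraticGrammar T} {ℓ n : ℕ}
    {s : List (Symbol T (BlockNT g ℓ))} {γ : List (BlockFlag g ℓ)}
    {u : Fin n → List (Symbol T (BlockNT g ℓ))} {w : List T} :
    BlockYield g s γ (List.ofFn u).flatten w ↔
      ∃ v : Fin n → List T, w = (List.ofFn v).flatten ∧ ∀ i, BlockYield g s γ (u i) (v i) := by
  rw [BlockYield, attachFlag_flatten_ofFn]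
  exact Yield.flatten_ofFn_iff

theorem language_permutationGrammar (g : QuadraticGrammar T) {n : ℕ} (L : Language T)
    (hL : ∀ w, g.Generates g.initial w ↔ w ∈ L) (τ : Equiv.Perm (Fin (n + 1))) :
    (permutationGrammar g τ).language = L.permutedSubwords τ := by
  ext x
  refine mem_language_blockGrammar_iff.trans ⟨?_, ?_⟩
  · rintro ⟨γ, h⟩
    obtain ⟨v, rfl, hv⟩ := blockYield_flatten_ofFn_iff.1 h
    have h₀ := hv (τ.symm 0)
    rw [τ.apply_symm_apply] at h₀
    obtain ⟨u₀, u₁, hu, h₀, h₁⟩ := blockYield_pair_iff.1 h₀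
    obtain ⟨z, hz, hc, hb⟩ := exists_markedWord_of_blockYield g.initial 0 (Fin.last (n + 1))
      (Fin.zero_le _) (Fin.cons u₀ (Fin.cons u₁ fun t : Fin n => v (τ.symm t.succ)))
      (Fin.cases h₀ (Fin.cases h₁ fun t => by
        have := hv (τ.symm t.succ)
        rw [τ.apply_symm_apply] at this
        exact this))
    replace hc : markCount z = n + 1 := by simpa using hc
    have hb₀ : u₀ = markedBlock 0 z 0 := hb 0
    have hb₁ : u₁ = markedBlock 0 z 1 := hb 1
    have hb₂ (t : Fin n) : v (τ.symm t.succ) = markedBlock 0 z (t + 2) := hb t.succ.succ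
    have hw : (fun t => v (τ.symm t)) = Fin.cons (markedBlock 0 z 0 ++ markedBlock 0 z 1)
        fun t : Fin n => markedBlock 0 z (t + 2) := by
      funext t
      refine Fin.cases ?_ (fun t => ?_) t
      · rw [hu, hb₀, hb₁]; rfl
      · rw [hb₂]; rfl
    refine ⟨fun t => v (τ.symm t), ?_, ?_, by simp⟩
    · rw [hw]
      refine Fin.cases ?_ fun t => ?_
      · have := markedBlock_ne_nil (i := 0) (z := z) (k := 1) (by omega) (by omega)
        simp [this]
      · exact markedBlock_ne_nil (by omega) (by omega)
    · rw [hw, flatten_ofFn_markedBlock hc]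
      exact (hL _).1 hz
  · rintro ⟨w, hw, hwL, rfl⟩
    have hw' : ∀ v ∈ List.ofFn w, v ≠ [] := by
      rw [List.forall_mem_ofFn_iff]
      exact hw
    obtain ⟨γ, -, hγ⟩ := exists_flags_of_generates
      (s := (List.ofFn fun i => subwordString g n (τ i)).flatten) ((hL _).2 hwL)
      (markStarts (List.ofFn w)) (map_fst_markStarts _) 0 (Fin.last (n + 1))
      (by rw [markCount_markStarts hw', List.length_ofFn]; simp)
    replace hγ := hγ []
    rw [List.append_nil] at hγ
    have hblock (t : Fin (n + 1)) : markedBlock 0 (markStarts (List.ofFn w)) (t + 1) = w t := by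
      have := markedBlock_markStarts hw' 0 t (by rw [List.length_ofFn]; exact t.2)
      rwa [List.getElem_ofFn, Nat.zero_add] at this
    refine ⟨γ, blockYield_flatten_ofFn_iff.2 ⟨_, rfl, fun i => ?_⟩⟩
    generalize τ i = t
    refine Fin.cases ?_ (fun t => ?_) t
    · refine blockYield_pair_iff.2 ⟨[], w 0, rfl, ?_, ?_⟩
      · have := hγ 0
        rwa [Fin.val_zero, markedBlock_markStarts_self hw'] at this
      · have := hγ 1
        rwa [← hblock 0]
    · have := hγ t.succ.succ
      rwa [← hblock t.succ]

/-- Without subwords there is no letter to mark; the only possible word is the empty one. -/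
lemma isIndexed_permutedSubwords_zero (L : Language T) (τ : Equiv.Perm (Fin 0)) :
    (L.permutedSubwords τ).IsIndexed := by
  classical
  have hmem (x : List T) : x ∈ L.permutedSubwords τ ↔ [] ∈ L ∧ x = [] := by
    constructor
    · rintro ⟨w, -, hw, rfl⟩
      exact ⟨by simpa using hw, by simp⟩
    · rintro ⟨h, rfl⟩
      exact ⟨Fin.elim0, fun i => i.elim0, by simpa using h, by simp⟩
  let g : IndexedGrammar T :=
    { NT := Unit
      Flag := Unit
      initial := ()
      productions := if [] ∈ L then {.plain () []} else ∅ }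
  refine ⟨g, ?_⟩
  ext x
  rw [hmem, g.mem_language_iff_yield, Yield.singleton_iff]
  constructor
  · rintro ⟨s, ⟨p, hp, he⟩, hs⟩
    by_cases h : [] ∈ L
    · simp only [g, if_pos h, Finset.mem_singleton] at hp
      subst hp
      cases he
      exact ⟨h, Yield.nil_iff.1 hs⟩
    · simp [g, h] at hp
  · rintro ⟨h, rfl⟩
    exact ⟨[], ⟨.plain () [], by simp [g, h], .plain () [] []⟩, .nil⟩

end Permutation

theorem mainTheorem2 {T : Type*} (ℓ : ℕ) (τ : Equiv.Perm (Fin ℓ)) (L : Language T)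
    (hL : L.IsContextFree) : (L.permutedSubwords τ).IsIndexed := by
  obtain ⟨G, rfl⟩ := hL
  cases ℓ with
  | zero => exact isIndexed_permutedSubwords_zero _ τ
  | succ n =>
    obtain ⟨g, hg⟩ := G.exists_quadraticGrammar
    exact ⟨permutationGrammar g τ, language_permutationGrammar g _ hg τ⟩
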